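/- Write $\Delta y(z)=y(z+1)-y(z)$, $\Delta^2=\Delta\circ\Delta$ and $z^{\underline{n}}=z(z-1)\cdots(z-n+1)$, $z^{\underline{0}}=1$. The binomial series $$y(z)=\sum_{n=0}^\infty \frac{(-1)^n}{(2n)!}\,z^{\underline{n}}$$ converges uniformly on every compact subset of $\mathbb C$, and its sum $y$ is an entire function of order of growth $\limsup_{r\to\infty}\frac{\log\log M(r,y)}{\log r}=\frac12$, where $M(r,y)=\max_{|z|=r}|y(z)|$, satisfying $$(4z+6)\Delta^2y(z)+3\Delta y(z)+y(z)=0\qquad(z\in\mathbb C).$$ Moreover, the meromorphic function $$f(z)=\frac{8z+4}{8z+1}\left(-\frac{\Delta y(z)}{y(z)}\right)-\frac{3}{8z+1}$$ on $\mathbb C$ is transcendental (that is, not a rational function), has order of growth $\rho(f)=\limsup_{r\to\infty}\frac{\log^+ T(r,f)}{\log r}=\frac12$, where $T(r,f)$ is the Nevanlinna characteristic, and satisfies, as an identity of meromorphic functions, the difference Riccati equation $$f(z+1)=\frac{f(z)+A(z)}{1-f(z)},\qquad A(z)=\frac{16z+23}{64z^2+80z+9}.$$ In particular, there exists a transcendental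 meromorphic function of order $1/2$ satisfying a difference Riccati equation of this form with rational $A$. -/

import Mathlib

open Filter Set Metric

/-- The maximum modulus `M(r, f) = max_{|z| = r} |f z|` of an entire function. -/
noncomputable def maxModulus (f : ℂ → ℂ) (r : ℝ) : ℝ :=
  sSup ((fun z : ℂ => ‖f z‖) '' sphere (0 : ℂ) r)

/-- The order of growth `limsup_{r → ∞} log log M(r, f) / log r` of an entire function, as an
extended real number. Logarithms are truncated at `0`, which affects only constant functions (they
get order `0`). -/
noncomputable def entireOrder (f : ℂ → ℂ) : EReal :=
  limsup (fun r : ℝ =>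
    ((Real.posLog (Real.posLog (maxModulus f r)) / Real.log r : ℝ) : EReal)) atTop

/-- The order of growth `limsup_{r → ∞} log⁺ T(r, f) / log r` of a meromorphic function, as an
extended real number, where `T(r, f)` is the Nevanlinna characteristic. -/
noncomputable def meromorphicGrowthOrder (f : ℂ → ℂ) : EReal :=
  limsup (fun r : ℝ =>
    ((Real.posLog (ValueDistribution.characteristic f ⊤ r) / Real.log r : ℝ) : EReal)) atTop

/-- A meromorphic function on the plane is identified with any function that agrees with it off a
closed discrete set, so that the values given to it at its poles play no role. It is rational if
it is, in this sense, a quotient of two polynomials. -/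
def IsRationalFunction (f : ℂ → ℂ) : Prop :=
  ∃ p q : Polynomial ℂ, q ≠ 0 ∧ f =ᶠ[codiscrete ℂ] fun z => p.eval z / q.eval z

/-- A transcendental meromorphic function on the plane: meromorphic and not rational. -/
def IsTranscendentalMeromorphic (f : ℂ → ℂ) : Prop :=
  Meromorphic f ∧ ¬ IsRationalFunction f

/-- The partial sum `∑_{n < N} a n * z (z - 1) ⋯ (z - n + 1)` of the binomial series with
coefficients `a`. -/
noncomputable def binomialPartialSum (a : ℕ → ℂ) (N : ℕ) (z : ℂ) : ℂ :=
  ∑ n ∈ Finset.range N, a n * ∏ j ∈ Finset.range n, (z - (j : ℂ))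

/-- The binomial series with coefficients `a` converges to `y`, uniformly on compact sets. -/
def BinomialSeriesConvergesTo (a : ℕ → ℂ) (y : ℂ → ℂ) : Prop :=
  ∀ K : Set ℂ, IsCompact K → TendstoUniformlyOn (binomialPartialSum a) y atTop K

/-! Write `c n = (-1)^n / (2n)!`. The recurrence `(2n+2)(2n+1) c (n+1) = -c n` yields the difference
equation on comparing coefficients. The terms are at most `exp (2√r) / 2^n` on `|z| ≤ r`, and at `z
= -r` the series dominates that of `cosh √r`; hence `y` is entire of order `1/2`. The Riccati
equation is then algebra, `f` being a quotient of entire functions built from `y`.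

The hard part is that `f` has enough poles. For real `x ≥ 0`, inserting `w^n` in the series gives a
Kummer function `F w` with `F 1 = y x`, and `v t = exp (-t²/2) F (4t²)` solves `v'' = -(4x+1-t²) v`,
`v 0 = 1`, `v' 0 = 0`. Comparison with `cos (√(4x+1) t)` up to `t = 1/2` shows that `y x` has the
sign of `cos √(x+1/4)` whenever `√(x+1/4)` is a positive multiple of `π`
(`binomialSum_lower_bound`). So `y` has a zero in each interval between consecutive points `(nπ)² -
1/4`, `n ≥ 1`. At none of these zeros does `y (x+1)` vanish (`binomialSum_add_one_ne_zero`), so each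
is a pole of `f`.

Infinitely many poles rule out rationality, and their density gives `N(r, f) ≥ √r/8 - 3`. The bound
`T(r, f) = O(√r)` comes from the first main theorem and the growth of `y`. -/

/-! ### Convergence of the series and upper growth bound -/

/-- The falling factorial `z (z - 1) ⋯ (z - n + 1)` of a complex number. -/
noncomputable def fallingFactorial (n : ℕ) (z : ℂ) : ℂ :=
  ∏ j ∈ Finset.range n, (z - (j : ℂ))

/-- The coefficients `(-1) ^ n / (2 n)!`. -/
noncomputable def binomialCoeff (n : ℕ) : ℂ :=
  (-1 : ℂ) ^ n / (Nat.factorial (2 * n) : ℂ)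

/-- The sum of the binomial series with coefficients `(-1) ^ n / (2 n)!`. -/
noncomputable def binomialSum (z : ℂ) : ℂ :=
  ∑' n, binomialCoeff n * fallingFactorial n z

lemma fallingFactorial_succ (n : ℕ) (z : ℂ) :
    fallingFactorial (n + 1) z = fallingFactorial n z * (z - n) :=
  Finset.prod_range_succ _ _

lemma fallingFactorial_succ_add_one (n : ℕ) (z : ℂ) :
    fallingFactorial (n + 1) (z + 1) = (z + 1) * fallingFactorial n z := by
  simp only [fallingFactorial, Finset.prod_range_succ']
  push_cast
  simp only [add_sub_add_right_eq_sub, sub_zero]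
  ring

lemma differentiable_fallingFactorial (n : ℕ) : Differentiable ℂ (fallingFactorial n) := by
  induction n with
  | zero =>
    have : fallingFactorial 0 = fun _ => 1 := by ext; simp [fallingFactorial]
    rw [this]; fun_prop
  | succ n ih =>
    have : fallingFactorial (n + 1) = fun z => fallingFactorial n z * (z - n) := by
      ext z; exact fallingFactorial_succ n z
    rw [this]; fun_prop

lemma norm_fallingFactorial_le (n : ℕ) (z : ℂ) :
    ‖fallingFactorial n z‖ ≤ ∏ j ∈ Finset.range n, (‖z‖ + j) := by
  rw [fallingFactorial, norm_prod]
  refine Finset.prod_le_prod (fun _ _ => norm_nonneg _) fun j _ => ?_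
  simpa using norm_sub_le z (j : ℂ)

lemma factorial_two_mul_succ (n : ℕ) :
    ((Nat.factorial (2 * (n + 1)) : ℕ) : ℝ) =
      (2 * n + 2) * ((2 * n + 1) * (Nat.factorial (2 * n) : ℝ)) := by
  rw [show 2 * (n + 1) = 2 * n + 1 + 1 by ring, Nat.factorial_succ, Nat.factorial_succ]
  push_cast; ring

lemma norm_binomialCoeff (n : ℕ) : ‖binomialCoeff n‖ = 1 / (Nat.factorial (2 * n) : ℝ) := by
  simp [binomialCoeff]

lemma binomialCoeff_succ (n : ℕ) :
    (2 * n + 2) * (2 * n + 1) * binomialCoeff (n + 1) = -binomialCoeff n := by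
  have h : ((Nat.factorial (2 * (n + 1)) : ℕ) : ℂ) =
      (2 * n + 2) * ((2 * n + 1) * (Nat.factorial (2 * n) : ℂ)) := by
    exact_mod_cast congrArg (fun x : ℝ => (x : ℂ)) (factorial_two_mul_succ n)
  have h1 : (2 * n + 2 : ℂ) ≠ 0 := by norm_cast
  have h2 : (2 * n + 1 : ℂ) ≠ 0 := by norm_cast
  have h3 : (Nat.factorial (2 * n) : ℂ) ≠ 0 := by exact_mod_cast Nat.factorial_ne_zero _
  rw [binomialCoeff, binomialCoeff, h, pow_succ]
  field_simp

/-- While the indices are at most `r`, each factor is at most `2r`, and the quantity is bounded by a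
single term of the series of `exp (2√r)`. Beyond that, passing from `n` to `n + 1` cannot increase
it. The extra `2 ^ n` supplies geometric decay of the terms of the binomial series. -/
lemma risingFactorial_mul_two_pow_div_le {r : ℝ} (hr : 0 ≤ r) (n : ℕ) :
    (∏ j ∈ Finset.range n, (r + j)) * 2 ^ n / (Nat.factorial (2 * n) : ℝ) ≤
      Real.exp (2 * √r) := by
  induction n with
  | zero => simp
  | succ n ih =>
    by_cases h : (n : ℝ) ≤ r
    · calc
        _ ≤ (∏ _j ∈ Finset.range (n + 1), (2 * r)) * 2 ^ (n + 1) /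
            (Nat.factorial (2 * (n + 1)) : ℝ) := by
          gcongr with j hj
          have : (j : ℝ) ≤ n := by
            exact_mod_cast Nat.lt_succ_iff.1 (Finset.mem_range.1 hj)
          linarith
        _ = (2 * √r) ^ (2 * (n + 1)) / (Nat.factorial (2 * (n + 1)) : ℝ) := by
          rw [Finset.prod_const, Finset.card_range, ← mul_pow, pow_mul, mul_pow 2 (√r),
            Real.sq_sqrt hr]
          ring
        _ ≤ _ := Real.pow_div_factorial_le_exp _ (by positivity) _
    · push Not at h
      refine le_trans ?_ ih
      rw [Finset.prod_range_succ, factorial_two_mul_succ, div_le_div_iff₀ (by positivity)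
        (by positivity)]
      have hn : (0 : ℝ) ≤ n := Nat.cast_nonneg n
      have hP : 0 ≤ ∏ j ∈ Finset.range n, (r + j) := Finset.prod_nonneg fun _ _ => by positivity
      have key : (r + n) * 2 ≤ (2 * n + 2) * (2 * n + 1) := by nlinarith
      calc
        _ = ((∏ j ∈ Finset.range n, (r + j)) * 2 ^ n * (Nat.factorial (2 * n) : ℝ)) *
            ((r + n) * 2) := by ring
        _ ≤ ((∏ j ∈ Finset.range n, (r + j)) * 2 ^ n * (Nat.factorial (2 * n) : ℝ)) *
            ((2 * n + 2) * (2 * n + 1)) := by gcongr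
        _ = _ := by ring

lemma norm_binomialTerm_le {z : ℂ} {r : ℝ} (hz : ‖z‖ ≤ r) (n : ℕ) :
    ‖binomialCoeff n * fallingFactorial n z‖ ≤ Real.exp (2 * √r) * (1 / 2) ^ n := by
  have hr : 0 ≤ r := (norm_nonneg z).trans hz
  rw [norm_mul, norm_binomialCoeff, one_div_pow, mul_one_div, le_div_iff₀ (by positivity)]
  refine le_trans ?_ (risingFactorial_mul_two_pow_div_le hr n)
  calc
    _ ≤ 1 / (Nat.factorial (2 * n) : ℝ) * (∏ j ∈ Finset.range n, (r + j)) * 2 ^ n := by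
      gcongr
      refine (norm_fallingFactorial_le n z).trans ?_
      gcongr
    _ = _ := by ring

lemma hasSum_binomialSum (z : ℂ) :
    HasSum (fun n => binomialCoeff n * fallingFactorial n z) (binomialSum z) :=
  (Summable.of_norm_bounded (summable_geometric_two.mul_left _)
    (norm_binomialTerm_le le_rfl)).hasSum

lemma norm_binomialSum_le {z : ℂ} {r : ℝ} (hz : ‖z‖ ≤ r) :
    ‖binomialSum z‖ ≤ 2 * Real.exp (2 * √r) := by
  rw [mul_comm]
  exact tsum_of_norm_bounded (hasSum_geometric_two.mul_left _) (norm_binomialTerm_le hz)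

lemma binomialSeriesConvergesTo_binomialSum :
    BinomialSeriesConvergesTo binomialCoeff binomialSum := by
  intro K hK
  obtain ⟨r, hr⟩ := hK.isBounded.exists_norm_le
  exact tendstoUniformlyOn_tsum_nat (summable_geometric_two.mul_left (Real.exp (2 * √r)))
    fun n z hz => norm_binomialTerm_le (hr z hz) n

lemma differentiable_binomialSum : Differentiable ℂ binomialSum := by
  have h : TendstoLocallyUniformlyOn (binomialPartialSum binomialCoeff) binomialSum atTop univ :=
    (tendstoLocallyUniformlyOn_iff_forall_isCompact isOpen_univ).2
      fun K _ hK => binomialSeriesConvergesTo_binomialSum K hK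
  rw [← differentiableOn_univ]
  refine h.differentiableOn (Eventually.of_forall fun N => ?_) isOpen_univ
  refine Differentiable.differentiableOn ?_
  exact Differentiable.fun_sum fun n _ => (differentiable_fallingFactorial n).const_mul _

/-! ### The difference equation, and growth on the negative axis -/

lemma hasSum_fwdDiff {a : ℕ → ℂ} {y : ℂ → ℂ}
    (h : ∀ z, HasSum (fun n => a n * fallingFactorial n z) (y z)) (z : ℂ) :
    HasSum (fun n : ℕ => (a (n + 1) * (n + 1)) * fallingFactorial n z) (fwdDiff (1 : ℂ) y z) := by
  have h1 := (hasSum_nat_add_iff' 1).2 ((h (z + 1)).sub (h z))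
  have h0 : ∀ w, fallingFactorial 0 w = 1 := fun w => by simp [fallingFactorial]
  simp only [Finset.sum_range_one, h0, sub_self, sub_zero] at h1
  refine h1.congr_fun fun n => ?_
  rw [fallingFactorial_succ_add_one, fallingFactorial_succ]
  ring

lemma binomialSum_difference_equation (z : ℂ) :
    (4 * z + 6) * (fwdDiff (1 : ℂ))^[2] binomialSum z + 3 * fwdDiff (1 : ℂ) binomialSum z +
      binomialSum z = 0 := by
  have h0 := hasSum_binomialSum z
  have h1 := hasSum_fwdDiff hasSum_binomialSum z
  have h2 := hasSum_fwdDiff (hasSum_fwdDiff hasSum_binomialSum) z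
  -- Split `4z + 6 = 4(z - n) + (4n + 6)`: the first part raises the falling factorial by one
  -- degree, and by the recurrence the second cancels one copy of `Δy`.
  have h3 : HasSum (fun n : ℕ => 4 * (binomialCoeff (n + 1) * (n + 1) * n) * fallingFactorial n z)
      ((4 * z + 6) * (fwdDiff (1 : ℂ))^[2] binomialSum z + fwdDiff (1 : ℂ) binomialSum z) := by
    refine (hasSum_nat_add_iff' 1).1 ?_
    simp only [Finset.sum_range_one, Nat.cast_zero, mul_zero, zero_mul, sub_zero]
    refine ((h2.mul_left (4 * z + 6)).add h1).congr_fun fun n => ?_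
    have hc := binomialCoeff_succ (n + 1)
    rw [fallingFactorial_succ]
    push_cast at hc ⊢
    linear_combination -(n + 1) * fallingFactorial n z * hc
  have h4 := (h3.add (h1.mul_left 2)).add h0
  have h5 : HasSum (fun _ : ℕ => (0 : ℂ)) ((4 * z + 6) * (fwdDiff (1 : ℂ))^[2] binomialSum z +
      fwdDiff (1 : ℂ) binomialSum z + 2 * fwdDiff (1 : ℂ) binomialSum z + binomialSum z) := by
    refine h4.congr_fun fun n => ?_
    have hc := binomialCoeff_succ n
    linear_combination -fallingFactorial n z * hc
  have := h5.unique hasSum_zero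
  linear_combination this

lemma binomialSum_recurrence (z : ℂ) :
    (4 * z + 6) * binomialSum (z + 2) =
      (8 * z + 9) * binomialSum (z + 1) - (4 * z + 4) * binomialSum z := by
  have h := binomialSum_difference_equation z
  simp only [Function.iterate_succ, Function.iterate_zero, Function.comp_apply, id_eq,
    fwdDiff] at h
  rw [show z + 1 + 1 = z + 2 by ring] at h
  linear_combination h

/-- At `-r` the signs cancel, so the terms are nonnegative and dominate the terms `r ^ n / (2n)!` of
`cosh √r`. -/
lemma half_exp_sqrt_le_norm_binomialSum_neg {r : ℝ} (hr : 0 ≤ r) :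
    Real.exp (√r) / 2 ≤ ‖binomialSum (-r)‖ := by
  have h1 : ∀ n, binomialCoeff n * fallingFactorial n (-r : ℂ) =
      (((∏ j ∈ Finset.range n, (r + j)) / (Nat.factorial (2 * n) : ℝ) : ℝ) : ℂ) := by
    intro n
    have : fallingFactorial n (-r : ℂ) = (-1) ^ n * ∏ j ∈ Finset.range n, ((r : ℂ) + j) := by
      rw [fallingFactorial, ← Finset.card_range n, ← Finset.prod_const, Finset.card_range,
        ← Finset.prod_mul_distrib]
      exact Finset.prod_congr rfl fun j _ => by ring
    rw [this, binomialCoeff]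
    push_cast
    have h : ((-1 : ℂ) ^ n) * (-1) ^ n = 1 := by rw [← mul_pow]; simp
    linear_combination ((∏ j ∈ Finset.range n, ((r : ℂ) + j)) / (Nat.factorial (2 * n) : ℂ)) * h
  have h2 := (hasSum_binomialSum (-r : ℂ))
  simp only [h1] at h2
  have h3 := Complex.hasSum_re h2
  simp only [Complex.ofReal_re] at h3
  have h4 := Real.hasSum_cosh (√r)
  have h5 : Real.cosh (√r) ≤ (binomialSum (-r)).re := by
    refine hasSum_le (fun n => ?_) h4 h3
    rw [pow_mul, Real.sq_sqrt hr]
    gcongr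
    rw [← Finset.card_range n, ← Finset.prod_const, Finset.card_range]
    gcongr
    simp
  refine le_trans ?_ (h5.trans (Complex.re_le_norm _))
  rw [Real.cosh_eq]
  have := Real.exp_pos (-√r)
  linarith

/-! ### Generating function and the Weber equation -/

/-- The factor `n` produced by differentiation is absorbed by `n ≤ 2 ^ n`, at the price of doubling
the radius. This gives the majorant for termwise differentiation. -/
lemma abs_mul_nat_mul_pow_sub_one_le (a : ℝ) {ρ y : ℝ} (hρ : 0 < ρ) (hy : |y| ≤ ρ) (n : ℕ) :
    ‖a * (n * y ^ (n - 1))‖ ≤ |a| * (2 * ρ) ^ n * ρ⁻¹ := by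
  rw [Real.norm_eq_abs, abs_mul, abs_mul, abs_pow, Nat.abs_cast, mul_assoc |a|]
  refine mul_le_mul_of_nonneg_left ?_ (abs_nonneg a)
  rcases n with _ | n
  · simp only [Nat.cast_zero, zero_mul]; positivity
  · calc
      ((n + 1 : ℕ) : ℝ) * |y| ^ (n + 1 - 1) ≤ 2 ^ (n + 1) * ρ ^ n := by
        gcongr
        · exact_mod_cast (Nat.lt_two_pow_self (n := n + 1)).le
        · exact pow_le_pow_left₀ (abs_nonneg y) hy n
      _ = _ := by rw [mul_pow, pow_succ ρ]; field_simp

lemma hasDerivAt_tsum_pow {c : ℕ → ℝ} (hc : ∀ ρ : ℝ, 0 ≤ ρ → Summable fun n => |c n| * ρ ^ n)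
    (w : ℝ) :
    HasDerivAt (fun w => ∑' n, c n * w ^ n) (∑' n : ℕ, ((n + 1) * c (n + 1)) * w ^ n) w := by
  set ρ := |w| + 1 with hρ
  have hρ0 : 0 < ρ := by positivity
  have h2 := hc (2 * ρ) (by positivity)
  have hu : Summable fun n : ℕ => |c n| * (2 * ρ) ^ n * ρ⁻¹ := h2.mul_right _
  have key := hasDerivAt_tsum_of_isPreconnected (𝕜 := ℝ) (t := Ioo (-ρ) ρ) (y₀ := 0) (y := w)
    (g := fun n w => c n * w ^ n) (g' := fun n w => c n * (n * w ^ (n - 1))) hu isOpen_Ioo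
    isPreconnected_Ioo (fun n y _ => (hasDerivAt_pow n y).const_mul _) ?_ (by simp [hρ0])
    ?_ (abs_lt.1 (by linarith))
  · refine key.congr_deriv ?_
    have hs : Summable fun n : ℕ => c n * (n * w ^ (n - 1)) := by
      refine Summable.of_norm_bounded hu fun n => ?_
      exact abs_mul_nat_mul_pow_sub_one_le _ hρ0 (by linarith) n
    rw [hs.tsum_eq_zero_add]
    simp only [Nat.cast_zero, zero_mul, mul_zero, zero_add, Nat.add_sub_cancel]
    refine tsum_congr fun n => ?_
    push_cast; ring
  · intro n y hy
    exact abs_mul_nat_mul_pow_sub_one_le _ hρ0 (abs_lt.2 hy).le n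
  · refine (Summable.of_norm_bounded (hc 0 le_rfl) fun n => ?_)
    simp

lemma summable_abs_derivative_coeff {c : ℕ → ℝ}
    (hc : ∀ ρ : ℝ, 0 ≤ ρ → Summable fun n => |c n| * ρ ^ n) (ρ : ℝ) (hρ : 0 ≤ ρ) :
    Summable fun n : ℕ => |(n + 1) * c (n + 1)| * ρ ^ n := by
  have h := (summable_nat_add_iff 1).2 (hc (2 * (ρ + 1)) (by positivity))
  refine Summable.of_nonneg_of_le (fun n => by positivity) (fun n => ?_) h
  have h1 := abs_mul_nat_mul_pow_sub_one_le (c (n + 1)) (ρ := ρ + 1) (y := ρ) (by positivity)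
    (by rw [abs_of_nonneg hρ]; linarith) (n + 1)
  have h2 : ‖c (n + 1) * (((n + 1 : ℕ) : ℝ) * ρ ^ (n + 1 - 1))‖ =
      |(n + 1) * c (n + 1)| * ρ ^ n := by
    rw [Real.norm_eq_abs, Nat.add_sub_cancel, ← mul_assoc, abs_mul, abs_of_nonneg (pow_nonneg hρ n)]
    push_cast
    rw [mul_comm (c (n + 1))]
  rw [h2] at h1
  refine h1.trans (mul_le_of_le_one_right (by positivity) (inv_le_one_of_one_le₀ (by linarith)))

/-- The real value of `(-1) ^ n x (x - 1) ⋯ (x - n + 1) / (2 n)!`. -/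
noncomputable def realBinomialTerm (x : ℝ) (n : ℕ) : ℝ :=
  (binomialCoeff n * fallingFactorial n x).re

lemma ofReal_realBinomialTerm (x : ℝ) (n : ℕ) :
    (realBinomialTerm x n : ℂ) = binomialCoeff n * fallingFactorial n x := by
  have h : binomialCoeff n * fallingFactorial n x =
      (((-1) ^ n / (Nat.factorial (2 * n) : ℝ) * ∏ j ∈ Finset.range n, (x - j) : ℝ) : ℂ) := by
    simp [binomialCoeff, fallingFactorial]
  rw [realBinomialTerm, h, Complex.ofReal_re]

lemma realBinomialTerm_succ (x : ℝ) (n : ℕ) :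
    (2 * n + 2) * (2 * n + 1) * realBinomialTerm x (n + 1) = -(x - n) * realBinomialTerm x n := by
  have hc := binomialCoeff_succ n
  have : ((((2 * n + 2) * (2 * n + 1) * realBinomialTerm x (n + 1) : ℝ)) : ℂ) =
      ((-(x - n) * realBinomialTerm x n : ℝ) : ℂ) := by
    push_cast
    rw [ofReal_realBinomialTerm, ofReal_realBinomialTerm, fallingFactorial_succ]
    linear_combination fallingFactorial n x * (x - n) * hc
  exact_mod_cast this

lemma summable_realBinomialTerm (x : ℝ) (ρ : ℝ) (hρ : 0 ≤ ρ) :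
    Summable fun n => |realBinomialTerm x n| * ρ ^ n := by
  refine summable_of_ratio_norm_eventually_le (r := 1 / 2) (by norm_num) ?_
  filter_upwards [eventually_ge_atTop ⌈ρ * (|x| + 1)⌉₊] with n hn
  have hn' : ρ * (|x| + 1) ≤ n := (Nat.le_ceil _).trans (by exact_mod_cast hn)
  have h0 : (0 : ℝ) ≤ n := Nat.cast_nonneg n
  have hs := congrArg abs (realBinomialTerm_succ x n)
  rw [abs_mul, abs_mul (-(x - n)), abs_neg,
    abs_of_nonneg (by positivity : (0 : ℝ) ≤ (2 * n + 2) * (2 * n + 1))] at hs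
  have h1 : |x - n| ≤ |x| + n := by simpa using abs_sub x (n : ℝ)
  have h2 : ρ * |x - n| ≤ (2 * n + 2) * (2 * n + 1) / 2 := by
    have : ρ * |x - n| ≤ ρ * (|x| + n) := by gcongr
    have h3 : 0 ≤ ρ * |x| := by positivity
    have h4 : ρ ≤ n := by nlinarith
    nlinarith
  rw [Real.norm_of_nonneg (by positivity), Real.norm_of_nonneg (by positivity)]
  have hpos : (0 : ℝ) < (2 * n + 2) * (2 * n + 1) := by positivity
  refine le_of_mul_le_mul_left ?_ hpos
  calc
    _ = ((2 * n + 2) * (2 * n + 1) * |realBinomialTerm x (n + 1)|) * ρ ^ (n + 1) := by ring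
    _ = (ρ * |x - n|) * (|realBinomialTerm x n| * ρ ^ n) := by rw [hs]; ring
    _ ≤ ((2 * n + 2) * (2 * n + 1) / 2) * (|realBinomialTerm x n| * ρ ^ n) := by gcongr
    _ = _ := by ring

lemma binomialSum_ofReal (x : ℝ) :
    binomialSum x = ((∑' n, realBinomialTerm x n : ℝ) : ℂ) := by
  rw [Complex.ofReal_tsum, binomialSum]
  exact tsum_congr fun n => (ofReal_realBinomialTerm x n).symm

lemma summable_mul_pow_of_abs {c : ℕ → ℝ}
    (hc : ∀ ρ : ℝ, 0 ≤ ρ → Summable fun n => |c n| * ρ ^ n) (w : ℝ) :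
    Summable fun n => c n * w ^ n :=
  Summable.of_norm_bounded (hc |w| (abs_nonneg w)) fun n => by simp

/-- The generating function of the terms of the binomial series satisfies a confluent
hypergeometric differential equation. -/
lemma exists_kummer_solution (x : ℝ) :
    ∃ F F₁ F₂ : ℝ → ℝ, (∀ w, HasDerivAt F (F₁ w) w) ∧ (∀ w, HasDerivAt F₁ (F₂ w) w) ∧
      (∀ w, 4 * w * F₂ w = (w - 2) * F₁ w - x * F w) ∧ F 0 = 1 ∧
      F 1 = ∑' n, realBinomialTerm x n := by
  set c := realBinomialTerm x with hcdef
  have hc := summable_realBinomialTerm x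
  have hc1 := summable_abs_derivative_coeff hc
  have hc2 := summable_abs_derivative_coeff hc1
  refine ⟨_, _, _, hasDerivAt_tsum_pow hc, hasDerivAt_tsum_pow hc1, fun w => ?_, ?_,
    by simp [hcdef]⟩
  · have s0 := (summable_mul_pow_of_abs hc w).hasSum
    have s1 := (summable_mul_pow_of_abs hc1 w).hasSum
    have s2 := (summable_mul_pow_of_abs hc2 w).hasSum
    have t1 : HasSum (fun n : ℕ => n * c n * w ^ n) (w * ∑' n : ℕ, (n + 1) * c (n + 1) * w ^ n) := by
      refine (hasSum_nat_add_iff' 1).1 ?_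
      simp only [Finset.sum_range_one, Nat.cast_zero, zero_mul, sub_zero]
      refine (s1.mul_left w).congr_fun fun n => ?_
      push_cast; ring
    have t2 : HasSum (fun n : ℕ => n * ((n + 1) * c (n + 1)) * w ^ n)
        (w * ∑' n : ℕ, (n + 1) * (((n + 1 : ℕ) + 1) * c (n + 1 + 1)) * w ^ n) := by
      refine (hasSum_nat_add_iff' 1).1 ?_
      simp only [Finset.sum_range_one, Nat.cast_zero, zero_mul, sub_zero]
      refine (s2.mul_left w).congr_fun fun n => ?_
      push_cast; ring
    -- The coefficient of `w ^ n` is `(4n(n+1) + 2(n+1)) c (n+1) + (x - n) c n`, which vanishes by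
    -- the recurrence since `4n(n+1) + 2(n+1) = (2n+2)(2n+1)`.
    have t3 := (((t2.mul_left 4).add (s1.mul_left 2)).sub t1).add (s0.mul_left x)
    have t4 := (t3.congr_fun (g := fun _ => 0) fun n => by
      linear_combination -w ^ n * realBinomialTerm_succ x n).unique hasSum_zero
    linear_combination t4
  · rw [tsum_eq_single 0 fun n hn => by simp [hn]]
    simp [realBinomialTerm, binomialCoeff, fallingFactorial]

/-- Up to the factor `exp (1 / 8)`, the value at `x` of the binomial series is the value at `1 / 2`
of the even solution of a Weber equation. -/
lemma exists_weber_solution (x : ℝ) :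
    ∃ v v' : ℝ → ℝ, (∀ t, HasDerivAt v (v' t) t) ∧
      (∀ t, HasDerivAt v' (-(4 * x + 1 - t ^ 2) * v t) t) ∧ v 0 = 1 ∧ v' 0 = 0 ∧
      v (1 / 2) = Real.exp (-(1 / 8)) * ∑' n, realBinomialTerm x n := by
  obtain ⟨F, F₁, F₂, hF, hF₁, hode, h0, h1⟩ := exists_kummer_solution x
  have hsq : ∀ t : ℝ, HasDerivAt (fun t : ℝ => 4 * t ^ 2) (8 * t) t := fun t =>
    ((hasDerivAt_pow 2 t).const_mul 4).congr_deriv (by norm_num; ring)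
  have hE : ∀ t : ℝ, HasDerivAt (fun t : ℝ => Real.exp (-(t ^ 2 / 2)))
      (Real.exp (-(t ^ 2 / 2)) * -t) t := fun t =>
    ((hasDerivAt_pow 2 t).div_const 2).neg.exp.congr_deriv (by norm_num)
  have hu : ∀ t : ℝ, HasDerivAt (fun t => F (4 * t ^ 2)) (F₁ (4 * t ^ 2) * (8 * t)) t :=
    fun t => (hF (4 * t ^ 2)).comp t (hsq t)
  have hu₁ : ∀ t : ℝ, HasDerivAt (fun t => F₁ (4 * t ^ 2)) (F₂ (4 * t ^ 2) * (8 * t)) t :=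
    fun t => (hF₁ (4 * t ^ 2)).comp t (hsq t)
  refine ⟨fun t => Real.exp (-(t ^ 2 / 2)) * F (4 * t ^ 2),
    fun t => Real.exp (-(t ^ 2 / 2)) * (F₁ (4 * t ^ 2) * (8 * t) - t * F (4 * t ^ 2)),
    fun t => ?_, fun t => ?_, ?_, ?_, ?_⟩
  · exact ((hE t).mul (hu t)).congr_deriv (by ring)
  · refine ((hE t).mul (((hu₁ t).mul ((hasDerivAt_id t).const_mul 8)).sub
      ((hasDerivAt_id t).mul (hu t)))).congr_deriv ?_
    simp only [Pi.sub_apply, Pi.mul_apply, id_eq]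
    linear_combination 4 * Real.exp (-(t ^ 2 / 2)) * hode (4 * t ^ 2)
  · simp [h0]
  · simp
  · norm_num [h1]

/-- A quantitative form of the asymptotics of the even solution of a Weber equation. -/
lemma weber_solution_lower_bound {l : ℝ} (hl : 1 ≤ l) {v v' : ℝ → ℝ}
    (hv : ∀ t, HasDerivAt v (v' t) t) (hv' : ∀ t, HasDerivAt v' (-(l ^ 2 - t ^ 2) * v t) t)
    (h0 : v 0 = 1) (h0' : v' 0 = 0) :
    |v' (1 / 2)| ≤ l ∧
      3 / 4 ≤ v (1 / 2) * Real.cos (l * (1 / 2)) - v' (1 / 2) * Real.sin (l * (1 / 2)) / l := by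
  have hl0 : 0 < l := by linarith
  -- The energy `v'² + (l² - t²) v²` decreases for `t ≥ 0` and equals `l²` at `0`; this bounds both
  -- `v` and `v'`.
  have hE : ∀ t, HasDerivAt (fun t => v' t ^ 2 + (l ^ 2 - t ^ 2) * v t ^ 2) (-2 * t * v t ^ 2) t := by
    intro t
    refine (((hv' t).pow 2).add (((hasDerivAt_const t (l ^ 2)).sub (hasDerivAt_pow 2 t)).mul
      ((hv t).pow 2))).congr_deriv ?_
    simp
    ring
  have hanti : AntitoneOn (fun t => v' t ^ 2 + (l ^ 2 - t ^ 2) * v t ^ 2) (Ici 0) := by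
    refine antitoneOn_of_deriv_nonpos (convex_Ici 0)
      (fun t _ => (hE t).continuousAt.continuousWithinAt)
      (fun t _ => (hE t).differentiableAt.differentiableWithinAt) fun t ht => ?_
    rw [(hE t).deriv]
    have : 0 < t := by simpa using ht
    nlinarith [mul_nonneg this.le (sq_nonneg (v t))]
  have hle : ∀ t, 0 ≤ t → v' t ^ 2 + (l ^ 2 - t ^ 2) * v t ^ 2 ≤ l ^ 2 := fun t ht => by
    simpa [h0, h0'] using hanti (mem_Ici.2 le_rfl) (mem_Ici.2 ht) ht
  have hvb : ∀ t ∈ Icc (0 : ℝ) (1 / 2), |v t| ≤ 2 := by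
    intro t ht
    have h1 := hle t ht.1
    have h2 : t ^ 2 ≤ 1 / 4 := by nlinarith [ht.1, ht.2]
    refine abs_le_of_sq_le_sq ?_ (by norm_num)
    nlinarith [sq_nonneg (v' t), mul_nonneg (sub_nonneg.2 h2) (sq_nonneg (v t)),
      mul_nonneg (sub_nonneg.2 (one_le_pow₀ hl : 1 ≤ l ^ 2)) (sq_nonneg (v t))]
  refine ⟨abs_le_of_sq_le_sq ?_ hl0.le, ?_⟩
  · have := hle (1 / 2) (by norm_num)
    nlinarith [sq_nonneg (v (1 / 2)),
      mul_nonneg (sub_nonneg.2 (one_le_pow₀ hl : 1 ≤ l ^ 2)) (sq_nonneg (v (1 / 2)))]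
  -- For `v'' = -l² v` this combination would be constant. Here its derivative contains only the
  -- perturbation `t² v`.
  · have hp : ∀ t, HasDerivAt (fun t => v t * Real.cos (l * t) - v' t * Real.sin (l * t) / l)
        (-(t ^ 2 * v t * Real.sin (l * t) / l)) t := by
      intro t
      have hlt : HasDerivAt (fun t => l * t) l t := by
        simpa using (hasDerivAt_id t).const_mul l
      refine (((hv t).mul hlt.cos).sub (((hv' t).mul hlt.sin).div_const l)).congr_deriv ?_
      field_simp
      ring
    -- The derivative is at most `(1/4) · 2 / l ≤ 1/2`, so over length `1/2` the combination moves
    -- by at most `1/4` from its initial value `1`.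
    have hb := norm_image_sub_le_of_norm_deriv_le_segment' (C := 1 / 2) (a := 0) (b := 1 / 2)
      (fun t _ => (hp t).hasDerivWithinAt) (fun t ht => ?_) (1 / 2) (by norm_num)
    · simp only [Real.norm_eq_abs, h0, h0'] at hb
      norm_num at hb
      have := (abs_le.1 hb).1
      norm_num
      linarith
    · have h1 := hvb t (Ico_subset_Icc_self ht)
      have h2 : t ^ 2 ≤ 1 / 4 := by nlinarith [ht.1, ht.2]
      rw [norm_neg, Real.norm_eq_abs, abs_div, abs_mul, abs_mul, abs_of_pos hl0,
        abs_of_nonneg (sq_nonneg t), div_le_iff₀ hl0]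
      calc
        t ^ 2 * |v t| * |Real.sin (l * t)| ≤ 1 / 4 * 2 * 1 := by
          gcongr
          exact Real.abs_sin_le_one _
        _ ≤ _ := by linarith

lemma binomialSum_lower_bound {x : ℝ} (hx : 0 ≤ x) :
    ∃ η : ℝ, |η| ≤ 1 ∧ 3 / 4 ≤ Real.exp (-(1 / 8)) * (binomialSum x).re * Real.cos (√(x + 1 / 4)) +
      η * Real.sin (√(x + 1 / 4)) := by
  obtain ⟨v, v', hv, hv', h0, h0', h1⟩ := exists_weber_solution x
  have hl : √(4 * x + 1) * (1 / 2) = √(x + 1 / 4) := by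
    rw [show 4 * x + 1 = 2 ^ 2 * (x + 1 / 4) by ring, Real.sqrt_mul (by norm_num),
      Real.sqrt_sq (by norm_num)]
    ring
  have hl1 : 1 ≤ √(4 * x + 1) := Real.one_le_sqrt.2 (by linarith)
  have hsq : √(4 * x + 1) ^ 2 = 4 * x + 1 := Real.sq_sqrt (by linarith)
  obtain ⟨ha, hb⟩ := weber_solution_lower_bound hl1 hv (by simpa only [hsq] using hv') h0 h0'
  refine ⟨-(v' (1 / 2) / √(4 * x + 1)), ?_, ?_⟩
  · rw [abs_neg, abs_div, abs_of_pos (by linarith : 0 < √(4 * x + 1))]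
    exact div_le_one_of_le₀ ha (by positivity)
  · rw [hl, h1] at hb
    rw [binomialSum_ofReal, Complex.ofReal_re]
    refine hb.trans (le_of_eq ?_)
    ring

/-! ### Zeros on the positive axis -/

lemma sqrt_sq_pi_sub_add (n : ℕ) : √((n * Real.pi) ^ 2 - 1 / 4 + 1 / 4) = n * Real.pi := by
  rw [sub_add_cancel, Real.sqrt_sq (by positivity)]

lemma one_le_sq_mul_pi {n : ℕ} (hn : 1 ≤ n) : 9 ≤ (n * Real.pi) ^ 2 := by
  have h1 : (1 : ℝ) ≤ n := by exact_mod_cast hn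
  have h2 := Real.pi_gt_three
  have : 3 ≤ n * Real.pi := by nlinarith
  nlinarith

lemma neg_one_pow_mul_binomialSum_pos {n : ℕ} (hn : 1 ≤ n) :
    0 < (-1) ^ n * (binomialSum (((n * Real.pi) ^ 2 - 1 / 4 : ℝ) : ℂ)).re := by
  have h9 := one_le_sq_mul_pi hn
  obtain ⟨η, -, h⟩ := binomialSum_lower_bound (x := (n * Real.pi) ^ 2 - 1 / 4) (by linarith)
  rw [sqrt_sq_pi_sub_add, Real.cos_nat_mul_pi, Real.sin_nat_mul_pi] at h
  have he := Real.exp_pos (-(1 / 8))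
  by_contra hcon
  push Not at hcon
  nlinarith [mul_nonneg he.le (neg_nonneg.2 hcon)]

lemma exists_binomialSum_eq_zero {n : ℕ} (hn : 1 ≤ n) :
    ∃ x ∈ Ioo ((n * Real.pi) ^ 2 - 1 / 4 : ℝ) (((n + 1 : ℕ) * Real.pi) ^ 2 - 1 / 4),
      binomialSum (x : ℂ) = 0 := by
  set g : ℝ → ℝ := fun x => (-1) ^ n * (binomialSum (x : ℂ)).re with hg
  have hcont : Continuous g := by
    have := differentiable_binomialSum.continuous
    fun_prop
  have h1 := neg_one_pow_mul_binomialSum_pos hn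
  have h2 := neg_one_pow_mul_binomialSum_pos (n := n + 1) (by omega)
  have hle : (n * Real.pi) ^ 2 - 1 / 4 ≤ ((n + 1 : ℕ) * Real.pi) ^ 2 - 1 / 4 := by
    gcongr
    simp
  obtain ⟨x, hx, hx0⟩ := intermediate_value_Ioo' hle hcont.continuousOn
    (show (0 : ℝ) ∈ Ioo (g (((n + 1 : ℕ) * Real.pi) ^ 2 - 1 / 4)) (g ((n * Real.pi) ^ 2 - 1 / 4)) from
      ⟨by rw [pow_succ] at h2; simp only [hg]; linarith, h1⟩)
  refine ⟨x, hx, ?_⟩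
  have h3 : (binomialSum (x : ℂ)).re = 0 := by
    simpa [hg] using hx0
  rw [binomialSum_ofReal] at h3 ⊢
  rw [Complex.ofReal_re] at h3
  simp [h3]

lemma abs_sin_sqrt_of_binomialSum_eq_zero {x : ℝ} (hx : 0 ≤ x) (h : binomialSum (x : ℂ) = 0) :
    3 / 4 ≤ |Real.sin (√(x + 1 / 4))| := by
  obtain ⟨η, hη, h1⟩ := binomialSum_lower_bound hx
  rw [h] at h1
  simp only [Complex.zero_re, mul_zero, zero_mul, zero_add] at h1
  refine h1.trans ((le_abs_self _).trans ?_)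
  rw [abs_mul]
  exact mul_le_of_le_one_left (abs_nonneg _) hη

lemma binomialSum_add_natCast_eq_zero {x : ℝ} (hx : 0 ≤ x) (h0 : binomialSum (x : ℂ) = 0)
    (h1 : binomialSum (x + 1 : ℂ) = 0) (k : ℕ) :
    binomialSum (x + k : ℂ) = 0 ∧ binomialSum (x + k + 1 : ℂ) = 0 := by
  induction k with
  | zero => simpa using ⟨h0, h1⟩
  | succ k ih =>
    have hr := binomialSum_recurrence (x + k : ℂ)
    rw [ih.1, ih.2, mul_zero, mul_zero, sub_zero] at hr
    have hne : 4 * (x + k : ℂ) + 6 ≠ 0 := by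
      have : (4 * (x + k : ℝ) + 6 : ℝ) ≠ 0 := by positivity
      exact_mod_cast this
    push_cast
    refine ⟨by simpa only [add_assoc] using ih.2, ?_⟩
    have := (mul_eq_zero.1 hr).resolve_left hne
    rwa [show (x + (k + 1) + 1 : ℂ) = x + k + 2 by ring]

/-- Two consecutive zeros would propagate through the recurrence to all `x + k`. The numbers `√(x +
k + 1/4)` have gaps tending to zero, so one of them lies near a multiple of `π`, contradicting
`|sin| ≥ 3/4` at zeros. -/
lemma binomialSum_add_one_ne_zero {x : ℝ} (hx : 0 ≤ x) (h0 : binomialSum (x : ℂ) = 0) :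
    binomialSum (x + 1 : ℂ) ≠ 0 := by
  intro h1
  obtain ⟨n, hn⟩ := exists_nat_ge (x + 1)
  have hn1 : (1 : ℝ) ≤ n := by linarith
  have hnpi : 3 ≤ n * Real.pi := by nlinarith [Real.pi_gt_three]
  have hn_le : n ≤ n * Real.pi := by nlinarith [Real.pi_gt_three]
  have hxn : 0 ≤ (n * Real.pi) ^ 2 - 1 / 4 - x := by nlinarith
  set k := ⌊(n * Real.pi) ^ 2 - 1 / 4 - x⌋₊ with hk
  have hk1 : (k : ℝ) ≤ (n * Real.pi) ^ 2 - 1 / 4 - x := Nat.floor_le hxn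
  have hk2 : (n * Real.pi) ^ 2 - 1 / 4 - x < k + 1 := Nat.lt_floor_add_one _
  have hz := (binomialSum_add_natCast_eq_zero hx h0 h1 k).1
  have hs := abs_sin_sqrt_of_binomialSum_eq_zero (x := x + k) (by positivity)
    (by exact_mod_cast hz)
  set s := √(x + k + 1 / 4) with hsdef
  have hs0 : 0 ≤ s := Real.sqrt_nonneg _
  have hs2 : s ^ 2 = x + k + 1 / 4 := Real.sq_sqrt (by positivity)
  have h3 : 0 ≤ n * Real.pi - s := by nlinarith
  -- By the choice of `k`, `(nπ)² - s² < 1`, while `nπ + s ≥ 3`.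
  have h4 : n * Real.pi - s ≤ 1 / 3 := by nlinarith
  have h5 : |Real.sin s| = |Real.sin (n * Real.pi - s)| := by
    rw [Real.sin_sub, Real.sin_nat_mul_pi, Real.cos_nat_mul_pi]
    simp [abs_mul]
  rw [h5] at hs
  have := hs.trans Real.abs_sin_le_abs
  rw [abs_of_nonneg h3] at this
  linarith

/-! ### Orders of growth from two-sided bounds -/

open Topology ValueDistribution

lemma tendsto_posLog_div_log_of_le_sqrt {F : ℝ → ℝ} {c C : ℝ} (hc : 0 < c)
    (hl : ∀ᶠ r in atTop, c * √r ≤ F r) (hu : ∀ᶠ r in atTop, F r ≤ C * √r) :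
    Tendsto (fun r => Real.posLog (F r) / Real.log r) atTop (𝓝 (1 / 2)) := by
  have hsqrt : Tendsto (fun r : ℝ => c * √r) atTop atTop :=
    Real.tendsto_sqrt_atTop.const_mul_atTop hc
  have haux : ∀ a : ℝ, Tendsto (fun r : ℝ => a / Real.log r + 1 / 2) atTop (𝓝 (1 / 2)) := by
    intro a
    simpa only [zero_add] using (Real.tendsto_log_atTop.const_div_atTop a).add_const (1 / 2 : ℝ)
  refine tendsto_of_tendsto_of_tendsto_of_le_of_le' (haux (Real.log c)) (haux (Real.log C)) ?_ ?_
  all_goals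
    filter_upwards [hl, hu, hsqrt.eventually_ge_atTop 1, eventually_gt_atTop 1] with r h1 h2 h3 h4
    have hr : 0 < √r := Real.sqrt_pos.2 (by linarith)
    have hlog : 0 < Real.log r := Real.log_pos h4
    have hF : 1 ≤ F r := h3.trans h1
    have hC : 0 < C := pos_of_mul_pos_left (by linarith) hr.le
    rw [Real.posLog_eq_log (hF.trans (le_abs_self _)), div_add' _ _ _ hlog.ne',
      div_le_div_iff_of_pos_right hlog]
  · have := Real.log_le_log (by positivity) h1
    rw [Real.log_mul hc.ne' hr.ne', Real.log_sqrt (by linarith)] at this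
    linarith
  · have := Real.log_le_log (by linarith) h2
    rw [Real.log_mul hC.ne' hr.ne', Real.log_sqrt (by linarith)] at this
    linarith

lemma limsup_posLog_div_log_of_le_sqrt {F : ℝ → ℝ} {c C : ℝ} (hc : 0 < c)
    (hl : ∀ᶠ r in atTop, c * √r ≤ F r) (hu : ∀ᶠ r in atTop, F r ≤ C * √r) :
    limsup (fun r : ℝ => ((Real.posLog (F r) / Real.log r : ℝ) : EReal)) atTop =
      ((1 / 2 : ℝ) : EReal) :=
  ((continuous_coe_real_ereal.tendsto _).comp
    (tendsto_posLog_div_log_of_le_sqrt hc hl hu)).limsup_eq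

lemma posLog_exp {t : ℝ} (ht : 0 ≤ t) : Real.posLog (Real.exp t) = t := by
  rw [Real.posLog_apply, Real.log_exp, max_eq_right ht]

lemma two_le_exp_one : (2 : ℝ) ≤ Real.exp 1 := by
  have := Real.add_one_le_exp (1 : ℝ)
  linarith

lemma norm_binomialSum_le_exp {z : ℂ} {r : ℝ} (hz : ‖z‖ ≤ r) :
    ‖binomialSum z‖ ≤ Real.exp (1 + 2 * √r) := by
  rw [Real.exp_add]
  exact (norm_binomialSum_le hz).trans (by gcongr; exact two_le_exp_one)

lemma entireOrder_binomialSum : entireOrder binomialSum = ((1 / 2 : ℝ) : EReal) := by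
  refine limsup_posLog_div_log_of_le_sqrt (c := 1 / 2) (C := 3) (by norm_num) ?_ ?_
  · filter_upwards [eventually_ge_atTop 4] with r hr
    have h2 : 2 ≤ √r := Real.le_sqrt_of_sq_le (by linarith)
    have hb : BddAbove ((fun z : ℂ => ‖binomialSum z‖) '' sphere (0 : ℂ) r) := by
      refine ⟨Real.exp (1 + 2 * √r), ?_⟩
      rintro _ ⟨z, hz, rfl⟩
      exact norm_binomialSum_le_exp (mem_sphere_zero_iff_norm.1 hz).le
    have h1 : Real.exp (√r - 1) ≤ maxModulus binomialSum r := by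
      refine le_trans ?_ (le_csSup hb (mem_image_of_mem _ (x := (-r : ℂ)) ?_))
      · refine le_trans ?_ (half_exp_sqrt_le_norm_binomialSum_neg (by linarith))
        rw [Real.exp_sub]
        gcongr
        exact two_le_exp_one
      · rw [mem_sphere_zero_iff_norm, norm_neg, Complex.norm_real,
          Real.norm_of_nonneg (by linarith)]
    have h3 := Real.posLog_le_posLog (Real.exp_pos _).le h1
    rw [posLog_exp (by linarith)] at h3
    linarith
  · filter_upwards [eventually_ge_atTop 1] with r hr
    have h1 : 1 ≤ √r := Real.one_le_sqrt.2 hr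
    have h2 : maxModulus binomialSum r ≤ Real.exp (1 + 2 * √r) := by
      refine Real.sSup_le ?_ (Real.exp_pos _).le
      rintro _ ⟨z, hz, rfl⟩
      exact norm_binomialSum_le_exp (mem_sphere_zero_iff_norm.1 hz).le
    have h3 : 0 ≤ maxModulus binomialSum r :=
      Real.sSup_nonneg (by rintro _ ⟨z, -, rfl⟩; exact norm_nonneg _)
    have h4 := Real.posLog_le_posLog h3 h2
    rw [posLog_exp (by positivity)] at h4
    linarith

/-! ### Nevanlinna characteristic and poles of quotients of entire functions -/

lemma Differentiable.meromorphic {g : ℂ → ℂ} (hg : Differentiable ℂ g) : Meromorphic g :=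
  fun z => (hg.analyticAt z).meromorphicAt

lemma Differentiable.meromorphicOrderAt_ne_top {g : ℂ → ℂ} (hg : Differentiable ℂ g) {a : ℂ}
    (ha : g a ≠ 0) (z : ℂ) : meromorphicOrderAt g z ≠ ⊤ := by
  refine hg.meromorphic.exists_meromorphicOrderAt_ne_top_iff_forall.1 ⟨a, ?_⟩ z
  rw [(hg.analyticAt a).meromorphicOrderAt_eq, (hg.analyticAt a).analyticOrderAt_eq_zero.2 ha]
  simp

lemma Differentiable.eventually_codiscrete_ne_zero {g : ℂ → ℂ} (hg : Differentiable ℂ g) {a : ℂ}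
    (ha : g a ≠ 0) : ∀ᶠ z in codiscrete ℂ, g z ≠ 0 :=
  AnalyticOnNhd.preimage_zero_mem_codiscrete (fun z _ => hg.analyticAt z) ha

lemma characteristic_top_le_of_norm_le_exp {g : ℂ → ℂ} (hg : Differentiable ℂ g) {r B : ℝ}
    (hr : 0 ≤ r) (hB : 0 ≤ B) (h : ∀ z, ‖z‖ = r → ‖g z‖ ≤ Real.exp B) :
    characteristic g ⊤ r ≤ B := by
  have hdiv : 0 ≤ MeromorphicOn.divisor g univ :=
    MeromorphicOn.AnalyticOnNhd.divisor_nonneg fun z _ => hg.analyticAt z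
  have hcount : logCounting g ⊤ = 0 := by
    rw [logCounting_top, negPart_eq_zero.2 hdiv, map_zero]
  rw [characteristic, hcount, add_zero, proximity_top]
  refine Real.circleAverage_mono_on_of_le_circle
    hg.meromorphic.meromorphicOn.circleIntegrable_posLog_norm fun z hz => ?_
  rw [abs_of_nonneg hr, mem_sphere_zero_iff_norm] at hz
  rw [← posLog_exp hB]
  exact Real.posLog_le_posLog (norm_nonneg _) (h z hz)

/-- Subadditivity of `T` on products, together with the first main theorem, which replaces `T(r,
1/q)` by `T(r, q) + O(1)`. -/
lemma characteristic_mul_inv_top_le {p q : ℂ → ℂ} (hp : Differentiable ℂ p)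
    (hq : Differentiable ℂ q) {a b : ℂ} (ha : p a ≠ 0) (hb : q b ≠ 0) :
    ∃ C, ∀ r, 1 ≤ r →
      characteristic (p * q⁻¹) ⊤ r ≤ characteristic p ⊤ r + characteristic q ⊤ r + C := by
  refine ⟨max |Real.log ‖q 0‖| |Real.log ‖meromorphicTrailingCoeffAt q 0‖|, fun r hr => ?_⟩
  have h1 := characteristic_mul_top_le hr hp.meromorphic (hp.meromorphicOrderAt_ne_top ha)
    hq.meromorphic.inv fun z => by
      rw [meromorphicOrderAt_inv]
      have := hq.meromorphicOrderAt_ne_top hb z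
      lift meromorphicOrderAt q z to ℤ using this with n
      exact WithTop.coe_ne_top
  have h2 := (abs_le.1 (characteristic_sub_characteristic_inv_le hq.meromorphic (R := r))).1
  rw [Pi.add_apply] at h1
  linarith

lemma meromorphicOrderAt_mul_inv_neg {p q : ℂ → ℂ} (hp : Differentiable ℂ p)
    (hq : Differentiable ℂ q) {a b : ℂ} (ha : p a ≠ 0) (hb : q b ≠ 0) (h0 : q a = 0) :
    ∃ n : ℤ, n < 0 ∧ meromorphicOrderAt (p * q⁻¹) a = n := by
  have hpos : 0 < meromorphicOrderAt q a := by
    rw [← tendsto_zero_iff_meromorphicOrderAt_pos (hq.meromorphic a)]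
    have := (hq a).continuousAt.tendsto
    rw [h0] at this
    exact this.mono_left nhdsWithin_le_nhds
  have htop := hq.meromorphicOrderAt_ne_top hb a
  rw [meromorphicOrderAt_mul_of_ne_zero (hp.analyticAt a) ha, meromorphicOrderAt_inv]
  lift meromorphicOrderAt q a to ℤ using htop with n
  exact ⟨-n, by simpa using hpos, rfl⟩

/-- The counting function is monotone in the divisor, and `D` dominates the sum of the unit point
masses on `S`. -/
lemma sum_log_le_logCounting {D : Function.locallyFinsupp ℂ ℤ} (hD : 0 ≤ D) (S : Finset ℂ)
    (hS : ∀ e ∈ S, 1 ≤ D e) {r : ℝ} (hr : 1 ≤ r) (hSr : ∀ e ∈ S, ‖e‖ ≤ r) :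
    ∑ e ∈ S, (Real.log r - Real.log ‖e‖) ≤ Function.locallyFinsuppWithin.logCounting D r := by
  classical
  have hle : ∑ e ∈ S, Function.locallyFinsuppWithin.single e (1 : ℤ) ≤ D := by
    intro x
    rw [Function.locallyFinsuppWithin.coe_sum, Finset.sum_apply]
    simp only [Function.locallyFinsuppWithin.single_apply, Finset.sum_ite_eq]
    split_ifs with h
    · exact hS x h
    · exact hD x
  have h := Function.locallyFinsuppWithin.logCounting_le hle hr
  rw [map_sum, Finset.sum_apply] at h
  refine le_trans (Finset.sum_le_sum fun e he => ?_) h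
  rw [Function.locallyFinsuppWithin.logCounting_single_eq_log_sub_const (hSr e he)]
  simp

/-- Every pole of `p / q` is a root of `q`, and a nonzero polynomial has finitely many roots. -/
lemma not_isRationalFunction_of_infinite_poles {f : ℂ → ℂ} {s : Set ℂ} (hs : s.Infinite)
    (hf : ∀ a ∈ s, meromorphicOrderAt f a < 0) : ¬ IsRationalFunction f := by
  rintro ⟨p, q, hq, hpq⟩
  refine hq (Polynomial.eq_zero_of_infinite_isRoot q (hs.mono fun a ha => ?_))
  by_contra hne
  have hev : f =ᶠ[𝓝[≠] a] fun z => p.eval z / q.eval z := by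
    have := disjoint_principal_right.1 (mem_codiscrete.1 hpq a)
    rwa [compl_compl] at this
  have han : AnalyticAt ℂ (fun z => p.eval z / q.eval z) a :=
    (p.differentiable.analyticAt a).div (q.differentiable.analyticAt a) hne
  have h := hf a ha
  rw [meromorphicOrderAt_congr hev] at h
  exact absurd han.meromorphicOrderAt_nonneg (not_le.2 h)

/-! ### The Riccati solution: poles, growth and equation -/

/-- The numerator of the solution of the difference Riccati equation. -/
noncomputable def riccatiNum (z : ℂ) : ℂ :=
  (8 * z + 4) * (binomialSum z - binomialSum (z + 1)) - 3 * binomialSum z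

/-- The denominator of the solution of the difference Riccati equation. -/
noncomputable def riccatiDen (z : ℂ) : ℂ :=
  (8 * z + 1) * binomialSum z

lemma differentiable_riccatiNum : Differentiable ℂ riccatiNum := by
  have h := differentiable_binomialSum
  unfold riccatiNum
  fun_prop

lemma differentiable_riccatiDen : Differentiable ℂ riccatiDen := by
  have h := differentiable_binomialSum
  unfold riccatiDen
  fun_prop

lemma binomialSum_zero : binomialSum 0 = 1 := by
  have h : ∀ n, n ≠ 0 → binomialCoeff n * fallingFactorial n 0 = 0 := fun n hn => by
    obtain ⟨m, rfl⟩ := Nat.exists_eq_succ_of_ne_zero hn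
    simp [fallingFactorial, Finset.prod_range_succ']
  rw [binomialSum, tsum_eq_single 0 h]
  simp [binomialCoeff, fallingFactorial]

lemma riccatiDen_zero_ne_zero : riccatiDen 0 ≠ 0 := by
  simp [riccatiDen, binomialSum_zero]

lemma exists_zeros_of_riccatiDen :
    ∃ x : ℕ → ℝ, StrictMono x ∧ ∀ n, 0 < x n ∧ x n ≤ ((n + 2) * Real.pi) ^ 2 ∧
      riccatiDen (x n) = 0 ∧ riccatiNum (x n) ≠ 0 := by
  choose x hx hx0 using fun n : ℕ => exists_binomialSum_eq_zero (n := n + 1) (by omega)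
  have hpos : ∀ n, 0 < x n := fun n => by
    have := one_le_sq_mul_pi (n := n + 1) (by omega)
    linarith [(hx n).1]
  refine ⟨x, strictMono_nat_of_lt_succ fun n => (hx n).2.trans (hx (n + 1)).1, fun n =>
    ⟨hpos n, ?_, ?_, ?_⟩⟩
  · have := (hx n).2
    push_cast at this
    rw [show (n : ℝ) + 2 = n + 1 + 1 by ring]
    linarith
  · rw [riccatiDen, hx0, mul_zero]
  · rw [riccatiNum, hx0, mul_zero, sub_zero, zero_sub]
    refine mul_ne_zero ?_ (neg_ne_zero.2 (binomialSum_add_one_ne_zero (hpos n).le (hx0 n)))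
    have h := hpos n
    have : (8 * x n + 4 : ℝ) ≠ 0 := by positivity
    exact_mod_cast this

lemma norm_riccati_le_exp {z : ℂ} {r : ℝ} (hz : ‖z‖ ≤ r) :
    ‖riccatiNum z‖ ≤ Real.exp (5 + 4 * √(r + 1)) ∧
      ‖riccatiDen z‖ ≤ Real.exp (5 + 4 * √(r + 1)) := by
  have hr : 0 ≤ r := (norm_nonneg z).trans hz
  set E := Real.exp (2 * √(r + 1)) with hE
  have hE0 : 0 < E := Real.exp_pos _
  have hz1 : ‖z + 1‖ ≤ r + 1 := (norm_add_le z 1).trans (by simpa using hz)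
  have h1 : ‖binomialSum z‖ ≤ 2 * E := norm_binomialSum_le (hz.trans (by linarith))
  have h2 : ‖binomialSum (z + 1)‖ ≤ 2 * E := norm_binomialSum_le hz1
  have hlin : ∀ m : ℕ, ‖8 * z + (m : ℂ)‖ ≤ 8 * r + m := fun m =>
    (norm_add_le _ _).trans (by simpa using hz)
  have hrE : r + 1 ≤ E := by
    have h3 := Real.add_one_le_exp (√(r + 1))
    have h4 : 0 ≤ √(r + 1) := Real.sqrt_nonneg _
    calc
      r + 1 = √(r + 1) ^ 2 := (Real.sq_sqrt (by linarith)).symm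
      _ ≤ Real.exp (√(r + 1)) ^ 2 := by gcongr; linarith
      _ = E := by rw [← Real.exp_nat_mul]; norm_num [hE]
  -- Since `r + 1 ≤ E` and `1 ≤ E`, the numerator is at most `8E · 4E + 6E ≤ 38E²`; the constant `5`
  -- is chosen so that `38 ≤ exp 5`.
  have hB : 38 * E * E ≤ Real.exp (5 + 4 * √(r + 1)) := by
    have h5 : (38 : ℝ) ≤ Real.exp 5 := by
      have h6 : (2.7 : ℝ) ≤ Real.exp 1 := by linarith [Real.exp_one_gt_d9]
      calc
        (38 : ℝ) ≤ 2.7 ^ 5 := by norm_num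
        _ ≤ Real.exp 1 ^ 5 := by gcongr
        _ = Real.exp 5 := by rw [← Real.exp_nat_mul]; norm_num
    rw [show 5 + 4 * √(r + 1) = 5 + 2 * √(r + 1) + 2 * √(r + 1) by ring, Real.exp_add,
      Real.exp_add]
    gcongr
  have h4 : ‖8 * z + 4‖ ≤ 8 * (r + 1) := by
    have := hlin 4
    push_cast at this
    linarith
  have h5 : ‖8 * z + 1‖ ≤ 8 * (r + 1) := by
    have := hlin 1
    push_cast at this
    linarith
  constructor
  · refine le_trans ?_ hB
    calc
      ‖riccatiNum z‖ ≤ ‖8 * z + 4‖ * (‖binomialSum z‖ + ‖binomialSum (z + 1)‖) +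
          3 * ‖binomialSum z‖ := by
        refine (norm_sub_le _ _).trans ?_
        rw [norm_mul, norm_mul]
        gcongr
        · exact norm_sub_le _ _
        · simp
      _ ≤ 8 * (r + 1) * (2 * E + 2 * E) + 3 * (2 * E) := by gcongr
      _ ≤ _ := by nlinarith
  · refine le_trans ?_ hB
    rw [riccatiDen, norm_mul]
    calc
      _ ≤ 8 * (r + 1) * (2 * E) := by gcongr
      _ ≤ _ := by nlinarith

lemma sqrt_div_sub_le_logCounting_riccati {r : ℝ} (hr : 1 ≤ r) :
    √r / 8 - 3 ≤ logCounting (riccatiNum * riccatiDen⁻¹) ⊤ r := by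
  obtain ⟨x, hmono, hx⟩ := exists_zeros_of_riccatiDen
  set f := riccatiNum * riccatiDen⁻¹ with hf
  have hmer : MeromorphicOn f univ := fun z _ =>
    (differentiable_riccatiNum.meromorphic z).mul (differentiable_riccatiDen.meromorphic z).inv
  -- For `k < n` one has `(k + 2)π ≤ √r / 2`, so the pole `x k` lies in `|z| ≤ r / 4` and
  -- contributes at least `log 4 > 1` to the counting function.
  set n := ⌊√r / 8 - 2⌋₊ with hn
  rcases lt_or_ge (√r / 8 - 2) 0 with hneg | hnonneg
  · linarith [logCounting_nonneg (f := f) (e := ⊤) hr]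
  have hn1 : (n : ℝ) ≤ √r / 8 - 2 := Nat.floor_le hnonneg
  have hn2 : √r / 8 - 2 < n + 1 := Nat.lt_floor_add_one _
  have hnorm : ∀ k < n, ‖(x k : ℂ)‖ ≤ r / 4 := by
    intro k hk
    rw [Complex.norm_real, Real.norm_of_nonneg (hx k).1.le]
    refine (hx k).2.1.trans ?_
    have hk' : (k : ℝ) ≤ n := by exact_mod_cast hk.le
    have hpi := Real.pi_le_four
    have h1 : (k + 2) * Real.pi ≤ √r / 2 := by
      calc
        (k + 2) * Real.pi ≤ (√r / 8) * 4 := by gcongr; linarith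
        _ = √r / 2 := by ring
    calc
      ((k + 2) * Real.pi) ^ 2 ≤ (√r / 2) ^ 2 := by gcongr
      _ = r / 4 := by rw [div_pow, Real.sq_sqrt (by linarith)]; norm_num
  have hinj : Function.Injective fun k : ℕ => (x k : ℂ) :=
    Complex.ofReal_injective.comp hmono.injective
  have key := sum_log_le_logCounting (negPart_nonneg (MeromorphicOn.divisor f univ))
    ((Finset.range n).map ⟨_, hinj⟩) ?_ hr ?_
  · rw [Finset.sum_map] at key
    rw [logCounting_top]
    refine le_trans ?_ key
    have h1 : ∑ k ∈ Finset.range n, (1 : ℝ) = n := by simp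
    refine (show _ ≤ (n : ℝ) by linarith).trans (h1 ▸ Finset.sum_le_sum fun k hk => ?_)
    have hk := hnorm k (Finset.mem_range.1 hk)
    have h0 : 0 < ‖(x k : ℂ)‖ := by
      rw [Complex.norm_real, Real.norm_of_nonneg (hx k).1.le]
      exact (hx k).1
    have h2 := Real.log_le_log h0 hk
    rw [Real.log_div (by linarith) (by norm_num), show (4 : ℝ) = 2 ^ 2 by norm_num,
      Real.log_pow] at h2
    have h3 := Real.log_two_gt_d9
    simp only [Function.Embedding.coeFn_mk]
    push_cast at h2
    linarith
  · intro e he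
    obtain ⟨k, -, rfl⟩ := Finset.mem_map.1 he
    obtain ⟨m, hm, hord⟩ := meromorphicOrderAt_mul_inv_neg differentiable_riccatiNum
      differentiable_riccatiDen (hx k).2.2.2 riccatiDen_zero_ne_zero (hx k).2.2.1
    rw [Function.locallyFinsuppWithin.negPart_apply]
    simp only [Function.Embedding.coeFn_mk]
    rw [MeromorphicOn.divisor_apply hmer (mem_univ _), hord, WithTop.untop₀_coe]
    exact le_trans (by omega) (neg_le_negPart m)
  · intro e he
    obtain ⟨k, hk, rfl⟩ := Finset.mem_map.1 he
    exact (hnorm k (Finset.mem_range.1 hk)).trans (by linarith)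

lemma meromorphicGrowthOrder_riccati :
    meromorphicGrowthOrder (riccatiNum * riccatiDen⁻¹) = ((1 / 2 : ℝ) : EReal) := by
  obtain ⟨x, -, hx⟩ := exists_zeros_of_riccatiDen
  obtain ⟨C, hC⟩ := characteristic_mul_inv_top_le differentiable_riccatiNum
    differentiable_riccatiDen (hx 0).2.2.2 riccatiDen_zero_ne_zero
  -- `√r/8 - 3 ≥ √r/16` once `√r ≥ 48`. Above, the two characteristics sum to at most `2(5 + 8√r) ≤
  -- 26√r`.
  refine limsup_posLog_div_log_of_le_sqrt (c := 1 / 16) (C := 26 + |C|) (by norm_num) ?_ ?_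
  · filter_upwards [eventually_ge_atTop 1, Real.tendsto_sqrt_atTop.eventually_ge_atTop 48]
      with r hr h48
    have h1 := sqrt_div_sub_le_logCounting_riccati hr
    have h2 := proximity_nonneg (f := riccatiNum * riccatiDen⁻¹) (a := ⊤) r
    rw [Pi.zero_apply] at h2
    rw [characteristic, Pi.add_apply]
    linarith
  · filter_upwards [eventually_ge_atTop 1] with r hr
    have hs : 1 ≤ √r := Real.one_le_sqrt.2 hr
    have hs1 : √(r + 1) ≤ 2 * √r := by
      rw [← Real.sqrt_sq (by norm_num : (0 : ℝ) ≤ 2), ← Real.sqrt_mul (by norm_num)]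
      exact Real.sqrt_le_sqrt (by linarith)
    have h1 := characteristic_top_le_of_norm_le_exp differentiable_riccatiNum (r := r)
      (by linarith) (by positivity) fun z hz => (norm_riccati_le_exp hz.le).1
    have h2 := characteristic_top_le_of_norm_le_exp differentiable_riccatiDen (r := r)
      (by linarith) (by positivity) fun z hz => (norm_riccati_le_exp hz.le).2
    have h3 : C ≤ |C| * √r := (le_abs_self C).trans (le_mul_of_one_le_right (abs_nonneg C) hs)
    linarith [hC r hr]

lemma isTranscendentalMeromorphic_riccati :
    IsTranscendentalMeromorphic (riccatiNum * riccatiDen⁻¹) := by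
  refine ⟨differentiable_riccatiNum.meromorphic.mul differentiable_riccatiDen.meromorphic.inv, ?_⟩
  obtain ⟨x, hmono, hx⟩ := exists_zeros_of_riccatiDen
  refine not_isRationalFunction_of_infinite_poles (s := range fun k => (x k : ℂ))
    (infinite_range_of_injective (Complex.ofReal_injective.comp hmono.injective)) ?_
  rintro _ ⟨k, rfl⟩
  obtain ⟨m, hm, hord⟩ := meromorphicOrderAt_mul_inv_neg differentiable_riccatiNum
    differentiable_riccatiDen (hx k).2.2.2 riccatiDen_zero_ne_zero (hx k).2.2.1
  rw [hord]
  exact_mod_cast hm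

lemma eventually_codiscrete_linear_ne_zero (b : ℂ) : ∀ᶠ z in codiscrete ℂ, 8 * z + b ≠ 0 :=
  Differentiable.eventually_codiscrete_ne_zero (g := fun z => 8 * z + b) (by fun_prop)
    (a := (1 - b) / 8) (by ring_nf; norm_num)

lemma eventually_codiscrete_binomialSum_ne_zero :
    ∀ᶠ z in codiscrete ℂ, binomialSum z ≠ 0 :=
  differentiable_binomialSum.eventually_codiscrete_ne_zero (a := 0) (by simp [binomialSum_zero])

lemma eventually_codiscrete_binomialSum_add_one_ne_zero :
    ∀ᶠ z in codiscrete ℂ, binomialSum (z + 1) ≠ 0 := by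
  have h := differentiable_binomialSum
  exact Differentiable.eventually_codiscrete_ne_zero (g := fun z => binomialSum (z + 1))
    (by fun_prop) (a := -1) (by simp [binomialSum_zero])

lemma riccati_eventuallyEq :
    riccatiNum * riccatiDen⁻¹ =ᶠ[codiscrete ℂ] fun z : ℂ =>
      (8 * z + 4) / (8 * z + 1) * (-(fwdDiff (1 : ℂ) binomialSum z / binomialSum z)) -
        3 / (8 * z + 1) := by
  filter_upwards [eventually_codiscrete_linear_ne_zero 1, eventually_codiscrete_binomialSum_ne_zero]
    with z h1 h2
  rw [Pi.mul_apply, Pi.inv_apply, riccatiNum, riccatiDen, fwdDiff]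
  field_simp
  ring

lemma riccati_equation :
    (fun z : ℂ => (riccatiNum * riccatiDen⁻¹) (z + 1)) =ᶠ[codiscrete ℂ] fun z : ℂ =>
      ((riccatiNum * riccatiDen⁻¹) z + (16 * z + 23) / (64 * z ^ 2 + 80 * z + 9)) /
        (1 - (riccatiNum * riccatiDen⁻¹) z) := by
  filter_upwards [eventually_codiscrete_linear_ne_zero 1, eventually_codiscrete_linear_ne_zero 4,
    eventually_codiscrete_linear_ne_zero 9, eventually_codiscrete_binomialSum_ne_zero,
    eventually_codiscrete_binomialSum_add_one_ne_zero] with z h1 h4 h9 hy hy1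
  have hrec := binomialSum_recurrence z
  -- The normalisation of `f` makes `1 - f` a multiple of `y (z+1) / y z`; the recurrence then
  -- eliminates `y (z+2)` from `f (z+1)`.
  have hsub : 1 - (riccatiNum * riccatiDen⁻¹) z =
      (8 * z + 4) * binomialSum (z + 1) / ((8 * z + 1) * binomialSum z) := by
    rw [Pi.mul_apply, Pi.inv_apply, riccatiNum, riccatiDen]
    field_simp
    ring
  have hnext : (riccatiNum * riccatiDen⁻¹) (z + 1) =
      (2 * (4 * z + 4) * binomialSum z - (8 * z + 9) * binomialSum (z + 1)) /
        ((8 * z + 9) * binomialSum (z + 1)) := by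
    rw [Pi.mul_apply, Pi.inv_apply, riccatiNum, riccatiDen, show 8 * (z + 1) + 1 = 8 * z + 9 by ring,
      show z + 1 + 1 = z + 2 by ring, ← div_eq_mul_inv]
    congr 1
    linear_combination -2 * hrec
  have hA : 64 * z ^ 2 + 80 * z + 9 = (8 * z + 1) * (8 * z + 9) := by ring
  have hA0 : (8 * z + 1) * (8 * z + 9) ≠ 0 := mul_ne_zero h1 h9
  rw [hsub, hnext, hA, eq_div_iff (div_ne_zero (mul_ne_zero h4 hy1) (mul_ne_zero h1 hy)),
    Pi.mul_apply, Pi.inv_apply, riccatiNum, riccatiDen, ← div_eq_mul_inv, div_mul_div_comm,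
    div_add_div _ _ (mul_ne_zero h1 hy) hA0,
    div_eq_div_iff (mul_ne_zero (mul_ne_zero h9 hy1) (mul_ne_zero h1 hy))
      (mul_ne_zero (mul_ne_zero h1 hy) hA0)]
  ring

theorem mainTheorem2 :
    ∃ y f : ℂ → ℂ,
      -- the binomial series `y`: an entire function of order `1/2` solving the linear equation
      BinomialSeriesConvergesTo (fun n : ℕ => (-1 : ℂ) ^ n / (Nat.factorial (2 * n) : ℂ)) y ∧
      Differentiable ℂ y ∧
      entireOrder y = ((1 / 2 : ℝ) : EReal) ∧
      (∀ z : ℂ, (4 * z + 6) * (fwdDiff (1 : ℂ))^[2] y z + 3 * fwdDiff (1 : ℂ) y z + y z = 0) ∧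
      -- `f` is obtained from `y`
      (f =ᶠ[codiscrete ℂ] fun z : ℂ =>
        (8 * z + 4) / (8 * z + 1) * (-(fwdDiff (1 : ℂ) y z / y z)) - 3 / (8 * z + 1)) ∧
      -- `f` is transcendental meromorphic, of order `1/2`, and solves the difference Riccati
      -- equation as an identity of meromorphic functions
      IsTranscendentalMeromorphic f ∧
      meromorphicGrowthOrder f = ((1 / 2 : ℝ) : EReal) ∧
      ((fun z : ℂ => f (z + 1)) =ᶠ[codiscrete ℂ] fun z : ℂ =>
        (f z + (16 * z + 23) / (64 * z ^ 2 + 80 * z + 9)) / (1 - f z)) := by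
  exact ⟨binomialSum, riccatiNum * riccatiDen⁻¹, binomialSeriesConvergesTo_binomialSum,
    differentiable_binomialSum, entireOrder_binomialSum, binomialSum_difference_equation,
    riccati_eventuallyEq, isTranscendentalMeromorphic_riccati, meromorphicGrowthOrder_riccati,
    riccati_equation⟩
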